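/- Let $(M,g)$ be either the plane $\mathbb{R}^2$ with a smooth Riemannian metric $g$ invariant under the translations by $\mathbb{Z}^2$, or the cylinder $S^1\times\mathbb{R}$ with a smooth Riemannian metric $g$ invariant under the translations $(z,t)\mapsto(z,t+k)$, $k\in\mathbb{Z}$. Let $K$ denote the Gaussian curvature of $g$, $\mu$ its Riemannian measure and $\Delta$ its non-negative Laplacian. For $a\in\mathbb{R}$ write $\Delta+aK\ge 0$ if $$\int_M\big(|df|_g^2+aKf^2\big)\,d\mu\ \ge\ 0$$ for every $C^1$ function $f:M\to\mathbb{R}$ with compact support, and let $$I(M,g;K)=\{a\in\mathbb{R} : \Delta+aK\ge 0\}.$$ Then $I(M,g;K)=\{0\}$ or $I(M,g;K)=\mathbb{R}$. Furthermore, $I(M,g;K)=\mathbb{R}$ if and only if $K\equiv 0$. -/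

import Mathlib

open scoped Manifold ContDiff

noncomputable section

namespace PeriodicSurface

/-! ### Riemannian geometry in local coordinates `(x¹, x²) ∈ ℝ²` -/

/-- The standard basis `∂₁ = (1, 0)`, `∂₂ = (0, 1)` of `ℝ²`. -/
def e : Fin 2 → ℝ × ℝ := ![(1, 0), (0, 1)]

/-- The partial derivative `∂ᵢ u` at `x`. -/
def partialDeriv (i : Fin 2) (u : ℝ × ℝ → ℝ) (x : ℝ × ℝ) : ℝ := fderiv ℝ u x (e i)

/-- Christoffel symbols of the second kind of the metric `∑ Gᵢⱼ dxⁱ dxʲ`: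
`Γᵏᵢⱼ = ½ ∑ₗ Gᵏˡ (∂ᵢ Gⱼₗ + ∂ⱼ Gᵢₗ - ∂ₗ Gᵢⱼ)`, where `(Gᵏˡ)` is the inverse matrix of `(Gₖₗ)`. -/
def christoffel (G : ℝ × ℝ → Matrix (Fin 2) (Fin 2) ℝ) (k i j : Fin 2) (x : ℝ × ℝ) : ℝ :=
  (1 / 2 : ℝ) * ∑ l, (G x)⁻¹ k l *
    (partialDeriv i (fun y => G y j l) x + partialDeriv j (fun y => G y i l) x
      - partialDeriv l (fun y => G y i j) x)

/-- Components of the curvature tensor `R(X, Y)Z = ∇_X ∇_Y Z - ∇_Y ∇_X Z - ∇_[X,Y] Z` of the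
Levi-Civita connection: `R(∂ᵢ, ∂ⱼ)∂ₖ = ∑ₗ (riemann G l k i j) ∂ₗ`. -/
def riemann (G : ℝ × ℝ → Matrix (Fin 2) (Fin 2) ℝ) (l k i j : Fin 2) (x : ℝ × ℝ) : ℝ :=
  partialDeriv i (christoffel G l j k) x - partialDeriv j (christoffel G l i k) x
    + ∑ m, (christoffel G l i m x * christoffel G m j k x
        - christoffel G l j m x * christoffel G m i k x)

/-- Gaussian curvature in coordinates: `⟨R(∂₁, ∂₂)∂₂, ∂₁⟩ / (G₁₁ G₂₂ - G₁₂²)`. -/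
def coordGaussCurvature (G : ℝ × ℝ → Matrix (Fin 2) (Fin 2) ℝ) (x : ℝ × ℝ) : ℝ :=
  (∑ l, riemann G l 1 0 1 x * G x l 0) / (G x).det

/-! ### Riemannian surfaces with a covering by the coordinate plane

Here `M` is a smooth surface, `p : ℝ² → M` is a surjective local diffeomorphism and `s : M → ℝ²`
is a right inverse of `p`.  Around every point `m` a local inverse of `p` defined near `m` and
sending `m` to `s m` is a chart of `M`, and it is in this chart that tensors are evaluated. -/

section Surface

variable {E : Type*} [NormedAddCommGroup E] [NormedSpace ℝ E]
  {H : Type*} [TopologicalSpace H] {I : ModelWithCorners ℝ E H}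
  {M : Type*} [TopologicalSpace M] [ChartedSpace H M] [IsManifold I 1 M]

variable (I M) in
/-- Smooth Riemannian metrics on the manifold `M`. -/
abbrev SmoothMetric : Type _ :=
  Bundle.ContMDiffRiemannianMetric I ∞ E (fun m : M => TangentSpace I m)

/-- The map `τ` preserves the metric: `τ^* g = g`. -/
def Preserves (g : SmoothMetric I M) (τ : M → M) : Prop :=
  ∀ (m : M) (v w : TangentSpace I m),
    g.inner (τ m) (mfderiv I I τ m v) (mfderiv I I τ m w) = g.inner m v w

/-- The coefficients `gᵢⱼ = g(∂ᵢ p, ∂ⱼ p)` of the metric in the coordinates `p`. -/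
def gram (g : SmoothMetric I M) (p : ℝ × ℝ → M) (x : ℝ × ℝ) : Matrix (Fin 2) (Fin 2) ℝ :=
  Matrix.of fun i j =>
    g.inner (p x) (mfderiv 𝓘(ℝ, ℝ × ℝ) I p x (e i)) (mfderiv 𝓘(ℝ, ℝ × ℝ) I p x (e j))

/-- The Gaussian curvature of `(M, g)` at `m`. -/
def gaussCurvature (g : SmoothMetric I M) (p : ℝ × ℝ → M) (s : M → ℝ × ℝ) (m : M) : ℝ :=
  coordGaussCurvature (gram g p) (s m)

/-- The squared norm `|df|² = ∑ gⁱʲ ∂ᵢf ∂ⱼf` of the differential of `f` at `m`. -/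
def normSqDiff (g : SmoothMetric I M) (p : ℝ × ℝ → M) (s : M → ℝ × ℝ) (f : M → ℝ) (m : M) : ℝ :=
  ∑ i, ∑ j, (gram g p (s m))⁻¹ i j
    * partialDeriv i (fun x => f (p x)) (s m) * partialDeriv j (fun x => f (p x)) (s m)

/-- The Riemannian measure of `(M, g)`: the image under `p` of `√(det g) dx¹ dx²` on the range
of `s`, a set of coordinates which meets every fibre of `p` in exactly one point. -/
def riemMeasure [MeasurableSpace M] (g : SmoothMetric I M) (p : ℝ × ℝ → M) (s : M → ℝ × ℝ) :
    MeasureTheory.Measure M :=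
  ((MeasureTheory.volume.restrict (Set.range s)).withDensity
    (fun x => ENNReal.ofReal (√ (gram g p x).det))).map p

/-- `Δ + V ≥ 0` in the sense of quadratic forms, on compactly supported `C¹` functions. -/
def IsNonnegative [MeasurableSpace M] (g : SmoothMetric I M) (p : ℝ × ℝ → M) (s : M → ℝ × ℝ)
    (V : M → ℝ) : Prop :=
  ∀ f : M → ℝ, ContMDiff I 𝓘(ℝ, ℝ) 1 f → HasCompactSupport f →
    0 ≤ ∫ m, (normSqDiff g p s f m + V m * f m ^ 2) ∂(riemMeasure g p s)

/-- The set `I(M, g; V) = {a ∈ ℝ | Δ + a V ≥ 0}`. -/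
def nonnegSet [MeasurableSpace M] (g : SmoothMetric I M) (p : ℝ × ℝ → M) (s : M → ℝ × ℝ)
    (V : M → ℝ) : Set ℝ :=
  {a | IsNonnegative g p s (fun m => a * V m)}

end Surface

/-! ### The plane and the cylinder -/

/-- The model of the plane `ℝ²` as a manifold. -/
abbrev planeModel : ModelWithCorners ℝ (ℝ × ℝ) (ℝ × ℝ) := 𝓘(ℝ, ℝ × ℝ)

/-- The model of the cylinder `S¹ × ℝ` as a product manifold. -/
abbrev cylModel : ModelWithCorners ℝ (EuclideanSpace ℝ (Fin 1) × ℝ)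
    (ModelProd (EuclideanSpace ℝ (Fin 1)) ℝ) := (𝓡 1).prod 𝓘(ℝ, ℝ)

/-- Global coordinates on the plane: the identity. -/
def planeParam : ℝ × ℝ → ℝ × ℝ := id

/-- The coordinates of a point of the plane. -/
def planeCoord : ℝ × ℝ → ℝ × ℝ := id

/-- The universal covering `(θ, t) ↦ (exp(iθ), t)` of the cylinder. -/
def cylParam (x : ℝ × ℝ) : Circle × ℝ := (Circle.exp x.1, x.2)

/-- The coordinates `(θ, t)`, with `-π < θ ≤ π`, of a point of the cylinder. -/
def cylCoord (m : Circle × ℝ) : ℝ × ℝ := (Complex.arg (m.1 : ℂ), m.2)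

theorem cylParam_cylCoord (m : Circle × ℝ) : cylParam (cylCoord m) = m :=
  Prod.ext (Circle.exp_arg m.1) rfl

theorem range_cylCoord : Set.range cylCoord = Set.Ioc (-Real.pi) Real.pi ×ˢ Set.univ := by
  ext x
  constructor
  · rintro ⟨m, rfl⟩
    exact ⟨⟨Complex.neg_pi_lt_arg _, Complex.arg_le_pi _⟩, trivial⟩
  · rintro ⟨h, -⟩
    exact ⟨cylParam x, Prod.ext (Circle.arg_exp h.1 h.2) rfl⟩

/-- The translation action of `ℤ²` on the plane. -/
def planeShift (k : ℤ × ℤ) (x : ℝ × ℝ) : ℝ × ℝ := (x.1 + k.1, x.2 + k.2)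

/-- The translation action of `ℤ` on the second factor of the cylinder. -/
def cylShift (k : ℤ) (m : Circle × ℝ) : Circle × ℝ := (m.1, m.2 + k)

instance : MeasurableSpace Circle := borel Circle

instance : BorelSpace Circle := ⟨rfl⟩

end PeriodicSurface

end

/-!
Write `E(f) = ∫ (|df|² + V f²)` over a fundamental cell of the period lattice. The lattice is
amenable: large blocks of `N` cells have only `o(N)` cells near their boundary, so a periodic
function `u` cut off near the boundary of a block has energy `N E(u) + o(N)`. Hence `Δ + V ≥ 0`
forces `E(u) ≥ 0` for all periodic `u`.

For `V = a K`, the curvature form is the differential of the periodic connection form of the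
orthonormal frame obtained from `∂₂, ∂₁` by the Gram–Schmidt process, hence has integral zero over
a cell. Thus `E(1) = 0`, so `1` minimizes `E`, and the first variation `2 ∫ V h` of `E` at `1` in
the direction `h = V` vanishes. This gives `a K = 0`.
-/

namespace PeriodicSurface

open MeasureTheory Set Filter Topology

/-! ### Partial derivatives -/

section PartialDeriv

variable {u v : ℝ × ℝ → ℝ} {x : ℝ × ℝ} (i : Fin 2)

theorem partialDeriv_sub (hu : DifferentiableAt ℝ u x) (hv : DifferentiableAt ℝ v x) :
    partialDeriv i (fun y => u y - v y) x = partialDeriv i u x - partialDeriv i v x := by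
  simp [partialDeriv, fderiv_fun_sub hu hv]

theorem partialDeriv_mul (hu : DifferentiableAt ℝ u x) (hv : DifferentiableAt ℝ v x) :
    partialDeriv i (fun y => u y * v y) x =
      partialDeriv i u x * v x + u x * partialDeriv i v x := by
  simp only [partialDeriv, fderiv_fun_mul hu hv, add_apply, smul_apply, smul_eq_mul]
  ring

theorem partialDeriv_const_mul (c : ℝ) (hu : DifferentiableAt ℝ u x) :
    partialDeriv i (fun y => c * u y) x = c * partialDeriv i u x := by
  simp [partialDeriv, fderiv_const_mul hu]

theorem partialDeriv_const_add (c : ℝ) :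
    partialDeriv i (fun y => c + u y) x = partialDeriv i u x := by
  simp [partialDeriv]

theorem partialDeriv_sum {ι : Type*} {s : Finset ι} {w : ι → ℝ × ℝ → ℝ}
    (hw : ∀ k ∈ s, DifferentiableAt ℝ (w k) x) :
    partialDeriv i (fun y => ∑ k ∈ s, w k y) x = ∑ k ∈ s, partialDeriv i (w k) x := by
  simp [partialDeriv, fderiv_fun_sum hw]

theorem partialDeriv_inv (hu : DifferentiableAt ℝ u x) (h : u x ≠ 0) :
    partialDeriv i (fun y => (u y)⁻¹) x = -partialDeriv i u x / u x ^ 2 := by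
  have hinv : fderiv ℝ (fun y => (u y)⁻¹) x = _ :=
    ((hasDerivAt_inv h).comp_hasFDerivAt x hu.hasFDerivAt).fderiv
  simp only [partialDeriv, hinv, smul_apply, smul_eq_mul]
  ring

theorem partialDeriv_sqrt (hu : DifferentiableAt ℝ u x) (h : u x ≠ 0) :
    partialDeriv i (fun y => √(u y)) x = partialDeriv i u x / (2 * √(u x)) := by
  simp only [partialDeriv, fderiv_sqrt hu h, smul_apply, smul_eq_mul]
  ring

theorem partialDeriv_congr (h : u =ᶠ[𝓝 x] v) : partialDeriv i u x = partialDeriv i v x := by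
  simp only [partialDeriv, h.fderiv_eq]

theorem abs_partialDeriv_le_norm_fderiv (u : ℝ × ℝ → ℝ) (x : ℝ × ℝ) :
    |partialDeriv i u x| ≤ ‖fderiv ℝ u x‖ :=
  (fderiv ℝ u x).unit_le_opNorm _ (by fin_cases i <;> simp [e])

theorem contDiff_partialDeriv (hu : ContDiff ℝ ∞ u) : ContDiff ℝ ∞ (partialDeriv i u) :=
  (hu.fderiv_right le_rfl).clm_apply contDiff_const

theorem continuous_partialDeriv (hu : ContDiff ℝ 1 u) : Continuous (partialDeriv i u) :=
  (hu.continuous_fderiv one_ne_zero).clm_apply continuous_const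

theorem partialDeriv_comm (hu : ContDiff ℝ 2 u) (i j : Fin 2) (x : ℝ × ℝ) :
    partialDeriv i (partialDeriv j u) x = partialDeriv j (partialDeriv i u) x := by
  have hdiff : DifferentiableAt ℝ (fderiv ℝ u) x :=
    (hu.fderiv_right (m := 1) le_rfl).differentiable one_ne_zero x
  have hsecond (k l : Fin 2) :
      partialDeriv k (partialDeriv l u) x = fderiv ℝ (fderiv ℝ u) x (e k) (e l) := by
    change fderiv ℝ (fun y => fderiv ℝ u y (e l)) x (e k) = _
    simp [fderiv_clm_apply hdiff (differentiableAt_const _)]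
  rw [hsecond, hsecond]
  exact hu.contDiffAt.isSymmSndFDerivAt (by simp) _ _

end PartialDeriv

/-! ### Curvature and connection form of a metric in coordinates -/

/-- The matrix-valued function `G` gives the coefficients of a smooth Riemannian metric on the
coordinate plane. -/
structure IsMetric (G : ℝ × ℝ → Matrix (Fin 2) (Fin 2) ℝ) : Prop where
  contDiff : ∀ i j, ContDiff ℝ ∞ fun x => G x i j
  posDef : ∀ x, (G x).PosDef

/-- The connection form `ω = ∑ᵢ ωᵢ dxⁱ` of the oriented orthonormal frame `E₁, E₂` with
`E₂ = ∂₂ / |∂₂|`, that is `ωᵢ = ⟨∇_∂ᵢ E₂, E₁⟩`. Only the component of `∇_∂ᵢ ∂₂` along `∂₁`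
contributes, and `⟨∂₁, E₁⟩ = √(det G) / |∂₂|`. -/
noncomputable def connectionForm (G : ℝ × ℝ → Matrix (Fin 2) (Fin 2) ℝ) (i : Fin 2)
    (x : ℝ × ℝ) : ℝ :=
  √(G x).det * (G x 1 1)⁻¹ * christoffel G 0 i 1 x

namespace IsMetric

variable {G : ℝ × ℝ → Matrix (Fin 2) (Fin 2) ℝ}

theorem symm (hG : IsMetric G) (x : ℝ × ℝ) (i j : Fin 2) : G x i j = G x j i := by
  simpa using ((hG.posDef x).isHermitian.apply i j).symm

theorem det_pos (hG : IsMetric G) (x : ℝ × ℝ) : 0 < (G x).det := (hG.posDef x).det_pos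

theorem sqrt_det_pos (hG : IsMetric G) (x : ℝ × ℝ) : 0 < √(G x).det :=
  Real.sqrt_pos.2 (hG.det_pos x)

theorem diag_pos (hG : IsMetric G) (x : ℝ × ℝ) (i : Fin 2) : 0 < G x i i := (hG.posDef x).diag_pos

theorem contDiff_det (hG : IsMetric G) : ContDiff ℝ ∞ fun x => (G x).det := by
  simp only [Matrix.det_fin_two]
  exact ((hG.contDiff 0 0).mul (hG.contDiff 1 1)).sub ((hG.contDiff 0 1).mul (hG.contDiff 1 0))

theorem contDiff_sqrt_det (hG : IsMetric G) : ContDiff ℝ ∞ fun x => √(G x).det :=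
  hG.contDiff_det.sqrt fun x => (hG.det_pos x).ne'

theorem contDiff_inv (hG : IsMetric G) (i j : Fin 2) : ContDiff ℝ ∞ fun x => (G x)⁻¹ i j := by
  simp only [Matrix.inv_def, Ring.inverse_eq_inv', Matrix.smul_apply, smul_eq_mul,
    Matrix.adjugate_fin_two]
  refine (hG.contDiff_det.inv fun x => (hG.det_pos x).ne').mul ?_
  fin_cases i <;> fin_cases j <;> simp [hG.contDiff, (hG.contDiff _ _).neg]

theorem contDiff_christoffel (hG : IsMetric G) (k i j : Fin 2) :
    ContDiff ℝ ∞ (christoffel G k i j) := by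
  refine contDiff_const.mul (ContDiff.sum fun l _ => (hG.contDiff_inv k l).mul ?_)
  exact ((contDiff_partialDeriv _ (hG.contDiff _ _)).add
    (contDiff_partialDeriv _ (hG.contDiff _ _))).sub (contDiff_partialDeriv _ (hG.contDiff _ _))

theorem contDiff_riemann (hG : IsMetric G) (l k i j : Fin 2) :
    ContDiff ℝ ∞ (riemann G l k i j) := by
  refine ((contDiff_partialDeriv _ (hG.contDiff_christoffel _ _ _)).sub
    (contDiff_partialDeriv _ (hG.contDiff_christoffel _ _ _))).add (ContDiff.sum fun m _ => ?_)
  exact ((hG.contDiff_christoffel _ _ _).mul (hG.contDiff_christoffel _ _ _)).sub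
    ((hG.contDiff_christoffel _ _ _).mul (hG.contDiff_christoffel _ _ _))

theorem contDiff_coordGaussCurvature (hG : IsMetric G) :
    ContDiff ℝ ∞ (coordGaussCurvature G) :=
  (ContDiff.sum fun _ _ => (hG.contDiff_riemann _ _ _ _).mul (hG.contDiff _ _)).div
    hG.contDiff_det fun x => (hG.det_pos x).ne'

theorem contDiff_connectionForm (hG : IsMetric G) (i : Fin 2) :
    ContDiff ℝ ∞ (connectionForm G i) :=
  (hG.contDiff_sqrt_det.mul ((hG.contDiff 1 1).inv fun x => (hG.diag_pos x 1).ne')).mul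
    (hG.contDiff_christoffel 0 i 1)

theorem differentiableAt (hG : IsMetric G) (i j : Fin 2) (x : ℝ × ℝ) :
    DifferentiableAt ℝ (fun y => G y i j) x := (hG.contDiff i j).differentiable (by simp) x

theorem differentiableAt_christoffel (hG : IsMetric G) (k i j : Fin 2) (x : ℝ × ℝ) :
    DifferentiableAt ℝ (christoffel G k i j) x :=
  (hG.contDiff_christoffel k i j).differentiable (by simp) x

theorem christoffel_symm (hG : IsMetric G) (k i j : Fin 2) (x : ℝ × ℝ) :
    christoffel G k i j x = christoffel G k j i x := by
  simp only [christoffel, funext fun y => hG.symm y i j, add_comm]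

theorem sum_mul_christoffel (hG : IsMetric G) (l i j : Fin 2) (x : ℝ × ℝ) :
    ∑ m, G x l m * christoffel G m i j x = (1 / 2 : ℝ) *
      (partialDeriv i (fun y => G y j l) x + partialDeriv j (fun y => G y i l) x
        - partialDeriv l (fun y => G y i j) x) := by
  set c : Fin 2 → ℝ := fun l => partialDeriv i (fun y => G y j l) x +
    partialDeriv j (fun y => G y i l) x - partialDeriv l (fun y => G y i j) x
  have hc : (G x).mulVec ((G x)⁻¹.mulVec c) = c := by
    rw [Matrix.mulVec_mulVec, Matrix.mul_nonsing_inv _ (hG.det_pos x).ne'.isUnit,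
      Matrix.one_mulVec]
  have hcl := congrFun hc l
  simp only [Matrix.mulVec, dotProduct, Fin.sum_univ_two] at hcl
  simp only [christoffel, Fin.sum_univ_two]
  linear_combination (1 / 2 : ℝ) * hcl

theorem partialDeriv_eq_sum_christoffel (hG : IsMetric G) (i j l : Fin 2) (x : ℝ × ℝ) :
    partialDeriv i (fun y => G y j l) x =
      ∑ m, (G x l m * christoffel G m i j x + G x j m * christoffel G m i l x) := by
  have hs (a b : Fin 2) : (fun y => G y a b) = fun y => G y b a := funext fun y => hG.symm y a b
  rw [Finset.sum_add_distrib, hG.sum_mul_christoffel, hG.sum_mul_christoffel, hs l j, hs i j,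
    hs i l]
  ring

theorem partialDeriv_partialDeriv_diag (hG : IsMetric G) (i j k : Fin 2) (x : ℝ × ℝ) :
    partialDeriv j (partialDeriv i fun y => G y k k) x =
      2 * ∑ m, (partialDeriv j (fun y => G y k m) x * christoffel G m i k x
        + G x k m * partialDeriv j (christoffel G m i k) x) := by
  have hfirst : partialDeriv i (fun y => G y k k) =
      fun y => 2 * ∑ m, G y k m * christoffel G m i k y := by
    ext y
    rw [hG.partialDeriv_eq_sum_christoffel, Finset.sum_add_distrib, two_mul]
  have hd (m : Fin 2) := hG.differentiableAt k m x
  have hΓ (m : Fin 2) := hG.differentiableAt_christoffel m i k x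
  rw [hfirst, partialDeriv_const_mul _ _ (by fun_prop), partialDeriv_sum _ (by fun_prop)]
  simp only [partialDeriv_mul _ (hd _) (hΓ _)]

/- The commutator of `∂ᵢ` and `∂ⱼ` annihilates `|∂ₖ|²`. -/
theorem sum_mul_riemann_self (hG : IsMetric G) (i j k : Fin 2) (x : ℝ × ℝ) :
    ∑ l, G x k l * riemann G l k i j x = 0 := by
  have hcomm := partialDeriv_comm ((hG.contDiff k k).of_le (by norm_cast)) i j x
  rw [hG.partialDeriv_partialDeriv_diag, hG.partialDeriv_partialDeriv_diag] at hcomm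
  simp only [hG.partialDeriv_eq_sum_christoffel, Fin.sum_univ_two, hG.symm x 1 0] at hcomm
  simp only [riemann, Fin.sum_univ_two]
  linear_combination (1 / 2 : ℝ) * hcomm

theorem coordGaussCurvature_eq_riemann_div (hG : IsMetric G) (x : ℝ × ℝ) :
    coordGaussCurvature G x = riemann G 0 1 0 1 x / G x 1 1 := by
  have horth := hG.sum_mul_riemann_self 0 1 1 x
  rw [coordGaussCurvature, div_eq_div_iff (hG.det_pos x).ne' (hG.diag_pos x 1).ne',
    Matrix.det_fin_two]
  simp only [Fin.sum_univ_two, hG.symm x 1 0] at horth ⊢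
  linear_combination G x 0 1 * horth

theorem partialDeriv_det (hG : IsMetric G) (i : Fin 2) (x : ℝ × ℝ) :
    partialDeriv i (fun y => (G y).det) x =
      2 * (G x).det * (christoffel G 0 i 0 x + christoffel G 1 i 1 x) := by
  have hd (j k : Fin 2) := hG.differentiableAt j k x
  simp only [Matrix.det_fin_two]
  rw [partialDeriv_sub _ (by fun_prop) (by fun_prop), partialDeriv_mul _ (hd 0 0) (hd 1 1),
    partialDeriv_mul _ (hd 0 1) (hd 1 0)]
  simp only [hG.partialDeriv_eq_sum_christoffel, Fin.sum_univ_two, hG.symm x 1 0]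
  ring

theorem partialDeriv_sqrt_det (hG : IsMetric G) (i : Fin 2) (x : ℝ × ℝ) :
    partialDeriv i (fun y => √(G y).det) x =
      √(G x).det * (christoffel G 0 i 0 x + christoffel G 1 i 1 x) := by
  have hne := (hG.sqrt_det_pos x).ne'
  rw [partialDeriv_sqrt _ (hG.contDiff_det.differentiable (by simp) x) (hG.det_pos x).ne',
    hG.partialDeriv_det, div_eq_iff (by positivity)]
  linear_combination (-2 * (christoffel G 0 i 0 x + christoffel G 1 i 1 x)) *
    Real.mul_self_sqrt (hG.det_pos x).le

theorem partialDeriv_connectionForm (hG : IsMetric G) (i j : Fin 2) (x : ℝ × ℝ) :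
    partialDeriv j (connectionForm G i) x =
      √(G x).det * (G x 1 1)⁻¹ * (partialDeriv j (christoffel G 0 i 1) x
        + christoffel G 0 i 1 x * (christoffel G 0 j 0 x - christoffel G 1 j 1 x
          - 2 * G x 0 1 * (G x 1 1)⁻¹ * christoffel G 0 j 1 x)) := by
  have hne := (hG.diag_pos x 1).ne'
  have hdiag := hG.differentiableAt 1 1 x
  have hsqrt : DifferentiableAt ℝ (fun y => √(G y).det) x :=
    hG.contDiff_sqrt_det.differentiable (by simp) x
  have hinv : DifferentiableAt ℝ (fun y => (G y 1 1)⁻¹) x := hdiag.inv hne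
  unfold connectionForm
  rw [partialDeriv_mul _ (hsqrt.fun_mul hinv) (hG.differentiableAt_christoffel 0 i 1 x),
    partialDeriv_mul _ hsqrt hinv, hG.partialDeriv_sqrt_det, partialDeriv_inv _ hdiag hne,
    hG.partialDeriv_eq_sum_christoffel]
  simp only [Fin.sum_univ_two, hG.symm x 1 0]
  field_simp
  ring

theorem coordGaussCurvature_mul_sqrt_det (hG : IsMetric G) (x : ℝ × ℝ) :
    coordGaussCurvature G x * √(G x).det =
      partialDeriv 0 (connectionForm G 1) x - partialDeriv 1 (connectionForm G 0) x := by
  have hne := (hG.diag_pos x 1).ne'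
  rw [hG.partialDeriv_connectionForm, hG.partialDeriv_connectionForm,
    hG.coordGaussCurvature_eq_riemann_div]
  simp only [riemann, Fin.sum_univ_two, hG.christoffel_symm _ 1 0]
  field_simp
  ring

end IsMetric

/-! ### Doubly periodic functions on the plane -/

/-- The cell `(x₀¹, x₀¹ + T¹] × (x₀², x₀² + T²]` with corner `x₀` and side lengths `T`. -/
def cell (x₀ T : ℝ × ℝ) : Set (ℝ × ℝ) := Ioc x₀.1 (x₀.1 + T.1) ×ˢ Ioc x₀.2 (x₀.2 + T.2)

/-- `F` is periodic with respect to the lattice spanned by `(T¹, 0)` and `(0, T²)`. -/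
structure DoublyPeriodic {α : Type*} (T : ℝ × ℝ) (F : ℝ × ℝ → α) : Prop where
  fst : Function.Periodic F (T.1, 0)
  snd : Function.Periodic F (0, T.2)

theorem measurableSet_cell (x₀ T : ℝ × ℝ) : MeasurableSet (cell x₀ T) :=
  measurableSet_Ioc.prod measurableSet_Ioc

theorem cell_subset_Icc_prod (x₀ T : ℝ × ℝ) :
    cell x₀ T ⊆ Icc x₀.1 (x₀.1 + T.1) ×ˢ Icc x₀.2 (x₀.2 + T.2) :=
  prod_mono Ioc_subset_Icc_self Ioc_subset_Icc_self

namespace DoublyPeriodic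

variable {T : ℝ × ℝ} {α β γ : Type*} {F : ℝ × ℝ → α} {F' : ℝ × ℝ → β}

theorem comp₂ (h : DoublyPeriodic T F) (h' : DoublyPeriodic T F') (φ : α → β → γ) :
    DoublyPeriodic T fun x => φ (F x) (F' x) :=
  ⟨fun x => by simp only [h.fst x, h'.fst x], fun x => by simp only [h.snd x, h'.snd x]⟩

theorem comp (h : DoublyPeriodic T F) (φ : α → γ) : DoublyPeriodic T fun x => φ (F x) :=
  h.comp₂ h fun a _ => φ a

theorem exists_mem_cell (h : DoublyPeriodic T F) (hT₁ : 0 < T.1) (hT₂ : 0 < T.2)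
    (x₀ x : ℝ × ℝ) : ∃ y ∈ cell x₀ T, F x = F y := by
  have h₁ := h.fst.sub_zsmul_eq (toIocDiv hT₁ x₀.1 x.1) (x := x)
  have h₂ := h.snd.sub_zsmul_eq (toIocDiv hT₂ x₀.2 x.2)
    (x := x - toIocDiv hT₁ x₀.1 x.1 • (T.1, (0 : ℝ)))
  refine ⟨_, ⟨?_, ?_⟩, h₁.symm.trans h₂.symm⟩
  · simpa using sub_toIocDiv_zsmul_mem_Ioc hT₁ x₀.1 x.1
  · simpa using sub_toIocDiv_zsmul_mem_Ioc hT₂ x₀.2 x.2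

theorem exists_norm_le {E : Type*} [SeminormedAddCommGroup E] {F : ℝ × ℝ → E}
    (h : DoublyPeriodic T F) (hT₁ : 0 < T.1) (hT₂ : 0 < T.2) (hF : Continuous F) :
    ∃ B, ∀ x, ‖F x‖ ≤ B := by
  obtain ⟨B, hB⟩ := (isCompact_Icc.prod isCompact_Icc : IsCompact (Icc 0 (0 + T.1) ×ˢ
    Icc 0 (0 + T.2))).exists_bound_of_continuousOn hF.continuousOn
  refine ⟨B, fun x => ?_⟩
  obtain ⟨y, hy, hxy⟩ := h.exists_mem_cell hT₁ hT₂ 0 x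
  exact hxy ▸ hB y (cell_subset_Icc_prod 0 T hy)

end DoublyPeriodic

section CellIntegral

variable {F : ℝ × ℝ → ℝ} {T : ℝ × ℝ}

theorem integrableOn_cell (hF : Continuous F) (x₀ T : ℝ × ℝ) : IntegrableOn F (cell x₀ T) :=
  (hF.continuousOn.integrableOn_compact (isCompact_Icc.prod isCompact_Icc)).mono_set
    (cell_subset_Icc_prod x₀ T)

theorem setIntegral_cell (hF : Continuous F) (x₀ : ℝ × ℝ) (hT₁ : 0 ≤ T.1) (hT₂ : 0 ≤ T.2) :
    ∫ z in cell x₀ T, F z =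
      ∫ x in x₀.1..x₀.1 + T.1, ∫ y in x₀.2..x₀.2 + T.2, F (x, y) := by
  rw [cell, Measure.volume_eq_prod, setIntegral_prod _ (integrableOn_cell hF x₀ T)]
  simp only [intervalIntegral.integral_of_le, le_add_iff_nonneg_right, hT₁, hT₂]

theorem DoublyPeriodic.setIntegral_block (h : DoublyPeriodic T F) (hF : Continuous F)
    (x₀ : ℝ × ℝ) (hT₁ : 0 ≤ T.1) (hT₂ : 0 ≤ T.2) (m n : ℕ) :
    ∫ z in cell x₀ (m * T.1, n * T.2), F z = m * n * ∫ z in cell x₀ T, F z := by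
  have hinner (x : ℝ) : ∫ y in x₀.2..x₀.2 + n * T.2, F (x, y) =
      n * ∫ y in x₀.2..x₀.2 + T.2, F (x, y) := by
    have hp : Function.Periodic (fun y => F (x, y)) T.2 := fun y => by simpa using h.snd (x, y)
    simpa using hp.intervalIntegral_add_zsmul_eq n x₀.2
      fun _ _ => (by fun_prop : Continuous fun y => F (x, y)).intervalIntegrable _ _
  have houter : ∫ x in x₀.1..x₀.1 + m * T.1, ∫ y in x₀.2..x₀.2 + T.2, F (x, y) =
      m * ∫ x in x₀.1..x₀.1 + T.1, ∫ y in x₀.2..x₀.2 + T.2, F (x, y) := by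
    have hp : Function.Periodic (fun x => ∫ y in x₀.2..x₀.2 + T.2, F (x, y)) T.1 := fun x =>
      intervalIntegral.integral_congr fun y _ => by simpa using h.fst (x, y)
    have hc : Continuous fun x => ∫ y in x₀.2..x₀.2 + T.2, F (x, y) :=
      intervalIntegral.continuous_parametric_intervalIntegral_of_continuous'
        (f := fun x y => F (x, y)) hF _ _
    simpa using hp.intervalIntegral_add_zsmul_eq m x₀.1 fun _ _ => hc.intervalIntegrable _ _
  rw [setIntegral_cell hF x₀ (by positivity) (by positivity), setIntegral_cell hF x₀ hT₁ hT₂]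
  simp only [hinner, intervalIntegral.integral_const_mul, houter]
  ring

theorem eqOn_zero_of_setIntegral_cell_eq_zero (hF : Continuous F) (h0 : ∀ x, 0 ≤ F x)
    (x₀ : ℝ × ℝ) (hT₁ : 0 < T.1) (hT₂ : 0 < T.2) (hi : ∫ z in cell x₀ T, F z = 0) :
    EqOn F 0 (cell x₀ T) := by
  have hae := (setIntegral_eq_zero_iff_of_nonneg_ae (Eventually.of_forall h0)
    (integrableOn_cell hF x₀ T)).1 hi
  refine Measure.eqOn_of_ae_eq hae hF.continuousOn continuousOn_const ?_
  rw [cell, interior_prod_eq, interior_Ioc, interior_Ioc, closure_prod_eq,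
    closure_Ioo (by linarith), closure_Ioo (by linarith)]
  exact prod_mono Ioc_subset_Icc_self Ioc_subset_Icc_self

end CellIntegral

/-! ### Periodic metrics -/

section Periodic

variable {G : ℝ × ℝ → Matrix (Fin 2) (Fin 2) ℝ} {u : ℝ × ℝ → ℝ} {c T : ℝ × ℝ}

theorem periodic_fderiv (h : Function.Periodic u c) : Function.Periodic (fderiv ℝ u) c :=
  fun x => by rw [← fderiv_comp_add_right, h.funext]

theorem periodic_partialDeriv (h : Function.Periodic u c) (i : Fin 2) :
    Function.Periodic (partialDeriv i u) c := fun x => by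
  simp only [partialDeriv, periodic_fderiv h x]

theorem periodic_christoffel (h : Function.Periodic G c) (k i j : Fin 2) :
    Function.Periodic (christoffel G k i j) c := fun x => by
  have hG (a b : Fin 2) : Function.Periodic (fun y => G y a b) c := fun y => by simp only [h y]
  simp only [christoffel, h x, periodic_partialDeriv (hG _ _) _ x]

theorem periodic_coordGaussCurvature (h : Function.Periodic G c) :
    Function.Periodic (coordGaussCurvature G) c := fun x => by
  simp only [coordGaussCurvature, riemann, h x, periodic_christoffel h _ _ _ x,
    periodic_partialDeriv (periodic_christoffel h _ _ _) _ x]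

theorem periodic_connectionForm (h : Function.Periodic G c) (i : Fin 2) :
    Function.Periodic (connectionForm G i) c := fun x => by
  simp only [connectionForm, h x, periodic_christoffel h _ _ _ x]

theorem DoublyPeriodic.coordGaussCurvature (h : DoublyPeriodic T G) :
    DoublyPeriodic T (coordGaussCurvature G) :=
  ⟨periodic_coordGaussCurvature h.fst, periodic_coordGaussCurvature h.snd⟩

/- Stokes' theorem on a cell: the connection form takes the same values on opposite sides. -/
theorem IsMetric.setIntegral_coordGaussCurvature_eq_zero (hG : IsMetric G)
    (h : DoublyPeriodic T G) (x₀ : ℝ × ℝ) (hT₁ : 0 ≤ T.1) (hT₂ : 0 ≤ T.2) :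
    ∫ z in cell x₀ T, coordGaussCurvature G z * √(G z).det = 0 := by
  set θ := connectionForm G
  have hθ (i : Fin 2) : ContDiff ℝ ∞ (θ i) := hG.contDiff_connectionForm i
  have hθd (i : Fin 2) (x : ℝ × ℝ) : HasFDerivAt (θ i) (fderiv ℝ (θ i) x) x :=
    ((hθ i).differentiable (by simp) x).hasFDerivAt
  have hcont : Continuous fun z => coordGaussCurvature G z * √(G z).det :=
    hG.contDiff_coordGaussCurvature.continuous.mul hG.contDiff_sqrt_det.continuous
  have hcurv (z : ℝ × ℝ) : coordGaussCurvature G z * √(G z).det =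
      fderiv ℝ (θ 1) z (1, 0) + (-fderiv ℝ (θ 0) z) (0, 1) := by
    rw [hG.coordGaussCurvature_mul_sqrt_det]
    simp [θ, partialDeriv, e, sub_eq_add_neg]
  have hstokes := integral2_divergence_prod_of_hasFDerivAt (θ 1) (fun x => -θ 0 x)
    (fderiv ℝ (θ 1)) (fun z => -fderiv ℝ (θ 0) z) x₀.1 x₀.2 (x₀.1 + T.1) (x₀.2 + T.2)
    (hθ 1).continuous.continuousOn (hθ 0).continuous.neg.continuousOn
    (fun x _ => hθd 1 x) (fun x _ => (hθd 0 x).neg) (by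
      simp only [← hcurv]
      exact hcont.continuousOn.integrableOn_compact (isCompact_uIcc.prod isCompact_uIcc))
  have hside₁ (y : ℝ) : θ 1 (x₀.1 + T.1, y) = θ 1 (x₀.1, y) := by
    simpa using periodic_connectionForm h.fst 1 (x₀.1, y)
  have hside₂ (x : ℝ) : θ 0 (x, x₀.2 + T.2) = θ 0 (x, x₀.2) := by
    simpa using periodic_connectionForm h.snd 0 (x, x₀.2)
  rw [setIntegral_cell hcont x₀ hT₁ hT₂]
  simp only [hcurv, hstokes, hside₁, hside₂, zero_add, sub_self]

end Periodic

/-! ### The energy density -/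

/-- The squared norm `|df|² = ∑ Gⁱʲ ∂ᵢf ∂ⱼf` of the differential of `f` in coordinates. -/
noncomputable def gradNormSq (G : ℝ × ℝ → Matrix (Fin 2) (Fin 2) ℝ) (f : ℝ × ℝ → ℝ)
    (x : ℝ × ℝ) : ℝ :=
  ∑ i, ∑ j, (G x)⁻¹ i j * partialDeriv i f x * partialDeriv j f x

/-- The density `(|df|² + V f²) √(det G)` of the quadratic form of `Δ + V` in coordinates. -/
noncomputable def energyDensity (G : ℝ × ℝ → Matrix (Fin 2) (Fin 2) ℝ) (V f : ℝ × ℝ → ℝ)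
    (x : ℝ × ℝ) : ℝ :=
  (gradNormSq G f x + V x * f x ^ 2) * √(G x).det

section Energy

variable {G : ℝ × ℝ → Matrix (Fin 2) (Fin 2) ℝ} {V f f' : ℝ × ℝ → ℝ} {T x : ℝ × ℝ}

theorem energyDensity_congr (h : f =ᶠ[𝓝 x] f') :
    energyDensity G V f x = energyDensity G V f' x := by
  simp only [energyDensity, gradNormSq, partialDeriv_congr _ h, h.eq_of_nhds]

theorem energyDensity_eq_zero (h : f =ᶠ[𝓝 x] 0) : energyDensity G V f x = 0 := by
  rw [energyDensity_congr h]
  simp [energyDensity, gradNormSq, partialDeriv]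

theorem energyDensity_one_add_mul (hV : DifferentiableAt ℝ V x) (t : ℝ) :
    energyDensity G V (fun y => 1 + t * V y) x = V x * √(G x).det
      + t * (2 * (V x ^ 2 * √(G x).det)) + t ^ 2 * energyDensity G V V x := by
  simp only [energyDensity, gradNormSq, partialDeriv_const_add, partialDeriv_const_mul _ t hV,
    Fin.sum_univ_two]
  ring

theorem IsMetric.gradNormSq_nonneg (hG : IsMetric G) (f : ℝ × ℝ → ℝ) (x : ℝ × ℝ) :
    0 ≤ gradNormSq G f x := by
  refine ((hG.posDef x).inv.posSemidef.dotProduct_mulVec_nonneg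
    fun i => partialDeriv i f x).trans_eq ?_
  simp only [gradNormSq, Fin.sum_univ_two, dotProduct, Matrix.mulVec, Pi.star_apply, star_trivial]
  ring

theorem IsMetric.continuous_gradNormSq (hG : IsMetric G) (hf : ContDiff ℝ 1 f) :
    Continuous (gradNormSq G f) :=
  continuous_finsetSum _ fun i _ => continuous_finsetSum _ fun j _ =>
    ((hG.contDiff_inv i j).continuous.mul (continuous_partialDeriv i hf)).mul
      (continuous_partialDeriv j hf)

theorem IsMetric.continuous_energyDensity (hG : IsMetric G) (hV : Continuous V)
    (hf : ContDiff ℝ 1 f) : Continuous (energyDensity G V f) :=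
  ((hG.continuous_gradNormSq hf).add (hV.mul (hf.continuous.pow 2))).mul
    hG.contDiff_sqrt_det.continuous

theorem periodic_energyDensity {c : ℝ × ℝ} (hG : Function.Periodic G c)
    (hV : Function.Periodic V c) (hf : Function.Periodic f c) :
    Function.Periodic (energyDensity G V f) c := fun x => by
  simp only [energyDensity, gradNormSq, hG x, hV x, hf x, periodic_partialDeriv hf _ x]

theorem DoublyPeriodic.energyDensity (hG : DoublyPeriodic T G) (hV : DoublyPeriodic T V)
    (hf : DoublyPeriodic T f) : DoublyPeriodic T (energyDensity G V f) :=
  ⟨periodic_energyDensity hG.fst hV.fst hf.fst, periodic_energyDensity hG.snd hV.snd hf.snd⟩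

theorem IsMetric.exists_abs_energyDensity_le (hG : IsMetric G) (hGT : DoublyPeriodic T G)
    (hV : Continuous V) (hVT : DoublyPeriodic T V) (hT₁ : 0 < T.1) (hT₂ : 0 < T.2) (B D : ℝ) :
    ∃ C, ∀ f x, |f x| ≤ B → (∀ i, |partialDeriv i f x| ≤ D) → |energyDensity G V f x| ≤ C := by
  have hsqrt := hG.contDiff_sqrt_det.continuous
  have hinv (i j : Fin 2) : ∃ A, ∀ x, |(G x)⁻¹ i j * √(G x).det| ≤ A :=
    (hGT.comp fun A => A⁻¹ i j * √A.det).exists_norm_le hT₁ hT₂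
      ((hG.contDiff_inv i j).continuous.mul hsqrt)
  choose A hA using hinv
  obtain ⟨A', hA'⟩ := (hVT.comp₂ hGT fun v A => v * √A.det).exists_norm_le hT₁ hT₂ (hV.mul hsqrt)
  refine ⟨∑ i, ∑ j, A i j * D * D + A' * B ^ 2, fun f x hB hD => ?_⟩
  have hsplit : energyDensity G V f x =
      ∑ i, ∑ j, (G x)⁻¹ i j * √(G x).det * partialDeriv i f x * partialDeriv j f x
        + V x * √(G x).det * f x ^ 2 := by
    simp only [energyDensity, gradNormSq, Fin.sum_univ_two]
    ring
  have hD0 : 0 ≤ D := (abs_nonneg _).trans (hD 0)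
  have hA'0 : 0 ≤ A' := (norm_nonneg _).trans (hA' x)
  rw [hsplit]
  refine (abs_add_le _ _).trans (add_le_add ?_ ?_)
  · refine (Finset.abs_sum_le_sum_abs _ _).trans (Finset.sum_le_sum fun i _ => ?_)
    refine (Finset.abs_sum_le_sum_abs _ _).trans (Finset.sum_le_sum fun j _ => ?_)
    have hA0 : 0 ≤ A i j := (abs_nonneg _).trans (hA i j x)
    rw [abs_mul, abs_mul]
    gcongr
    exacts [hA i j x, hD i, hD j]
  · rw [abs_mul, abs_pow]
    gcongr
    exact hA' x

/- The discriminant of `t ↦ E(1 + t V) = ∫ V + 2 t ∫ V² + t² E(V)` is not positive. -/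
theorem IsMetric.eq_zero_of_setIntegral_cell_nonneg (hG : IsMetric G) (hV : ContDiff ℝ 1 V)
    (hVT : DoublyPeriodic T V) (x₀ : ℝ × ℝ) (hT₁ : 0 < T.1) (hT₂ : 0 < T.2)
    (hmean : ∫ z in cell x₀ T, V z * √(G z).det ≤ 0)
    (h : ∀ t : ℝ, 0 ≤ ∫ z in cell x₀ T, energyDensity G V (fun y => 1 + t * V y) z) : V = 0 := by
  have hsqrt := hG.contDiff_sqrt_det.continuous
  have hVc := hV.continuous
  have hVsq : Continuous fun z => V z ^ 2 * √(G z).det := (hVc.pow 2).mul hsqrt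
  set c := ∫ z in cell x₀ T, V z * √(G z).det
  set Z := ∫ z in cell x₀ T, V z ^ 2 * √(G z).det
  set E := ∫ z in cell x₀ T, energyDensity G V V z
  have hexpand (t : ℝ) :
      ∫ z in cell x₀ T, energyDensity G V (fun y => 1 + t * V y) z =
        E * (t * t) + 2 * Z * t + c := by
    have hc : IntegrableOn (fun z => V z * √(G z).det) (cell x₀ T) :=
      integrableOn_cell (hVc.mul hsqrt) x₀ T
    have hZ := ((integrableOn_cell hVsq x₀ T).const_mul 2).const_mul t
    have hE := (integrableOn_cell (hG.continuous_energyDensity hVc hV) x₀ T).const_mul (t ^ 2)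
    simp only [energyDensity_one_add_mul (hV.differentiable one_ne_zero _)]
    rw [integral_add (hc.fun_add hZ) hE, integral_add hc hZ]
    simp only [integral_const_mul]
    ring
  have hquad (t : ℝ) : 0 ≤ E * (t * t) + 2 * Z * t + c := (h t).trans_eq (hexpand t)
  have hc : c = 0 := le_antisymm hmean (by simpa using hquad 0)
  have hdiscrim : discrim E (2 * Z) c ≤ 0 := discrim_le_zero hquad
  have hZ : Z = 0 := by
    rw [discrim, hc] at hdiscrim
    exact pow_eq_zero_iff two_ne_zero |>.1 (le_antisymm (by linarith) (sq_nonneg Z))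
  ext x
  obtain ⟨y, hy, hxy⟩ := hVT.exists_mem_cell hT₁ hT₂ x₀ x
  have hVy := eqOn_zero_of_setIntegral_cell_eq_zero hVsq (fun z => by positivity) x₀ hT₁ hT₂ hZ hy
  simpa [hxy, (hG.sqrt_det_pos y).ne'] using hVy

end Energy

/-! ### Cut-off functions -/

/-- The `C¹` function `ψ` is bounded by `1`, equal to `1` near `P` and to `0` off `Q`, and its
differential is bounded by `L`. -/
structure IsCutoff {E : Type*} [NormedAddCommGroup E] [NormedSpace ℝ E] (L : ℝ) (P Q : Set E)
    (ψ : E → ℝ) : Prop where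
  contDiff : ContDiff ℝ 1 ψ
  abs_le_one : ∀ x, |ψ x| ≤ 1
  norm_fderiv_le : ∀ x, ‖fderiv ℝ ψ x‖ ≤ L
  eventuallyEq_one : ∀ x ∈ P, ψ =ᶠ[𝓝 x] 1
  eq_zero : ∀ x ∉ Q, ψ x = 0

namespace IsCutoff

variable {E F : Type*} [NormedAddCommGroup E] [NormedSpace ℝ E] [NormedAddCommGroup F]
  [NormedSpace ℝ F] {L L' : ℝ} {P P' Q Q' : Set E} {ψ ψ' : E → ℝ}

theorem one : IsCutoff 0 univ univ (1 : E → ℝ) where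
  contDiff := contDiff_const
  abs_le_one := by simp
  norm_fderiv_le := by simp
  eventuallyEq_one _ _ := EventuallyEq.rfl
  eq_zero := by simp

theorem mono (h : IsCutoff L P Q ψ) (hP : P' ⊆ P) (hQ : Q ⊆ Q') : IsCutoff L P' Q' ψ where
  __ := h
  eventuallyEq_one x hx := h.eventuallyEq_one x (hP hx)
  eq_zero x hx := h.eq_zero x fun hx' => hx (hQ hx')

theorem subset (h : IsCutoff L P Q ψ) : P ⊆ Q := fun x hx => by
  by_contra hxQ
  exact one_ne_zero ((h.eventuallyEq_one x hx).eq_of_nhds.symm.trans (h.eq_zero x hxQ))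

theorem comp (h : IsCutoff L P Q ψ) {A : F → E} (hA : ContDiff ℝ 1 A) (hL : LipschitzWith 1 A) :
    IsCutoff L (A ⁻¹' P) (A ⁻¹' Q) (ψ ∘ A) where
  contDiff := h.contDiff.comp hA
  abs_le_one x := h.abs_le_one (A x)
  norm_fderiv_le x := by
    rw [fderiv_comp x (h.contDiff.differentiable one_ne_zero _)
      (hA.differentiable one_ne_zero x)]
    calc ‖(fderiv ℝ ψ (A x)).comp (fderiv ℝ A x)‖
        ≤ ‖fderiv ℝ ψ (A x)‖ * ‖fderiv ℝ A x‖ := ContinuousLinearMap.opNorm_comp_le _ _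
      _ ≤ ‖fderiv ℝ ψ (A x)‖ :=
        mul_le_of_le_one_right (norm_nonneg _) (norm_fderiv_le_of_lipschitz ℝ hL)
      _ ≤ L := h.norm_fderiv_le (A x)
  eventuallyEq_one x hx := hA.continuous.continuousAt.eventually (h.eventuallyEq_one (A x) hx)
  eq_zero x hx := h.eq_zero (A x) hx

theorem norm_fderiv_mul_le (h : IsCutoff L P Q ψ) {u : E → ℝ} {B D : ℝ} {x : E}
    (hu : DifferentiableAt ℝ u x) (hB : |u x| ≤ B) (hD : ‖fderiv ℝ u x‖ ≤ D) :
    ‖fderiv ℝ (fun y => u y * ψ y) x‖ ≤ B * L + D := by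
  rw [fderiv_fun_mul hu (h.contDiff.differentiable one_ne_zero x)]
  refine (norm_add_le _ _).trans (add_le_add ?_ ?_) <;> rw [norm_smul, Real.norm_eq_abs]
  · exact mul_le_mul hB (h.norm_fderiv_le x) (norm_nonneg _) ((abs_nonneg _).trans hB)
  · exact (mul_le_of_le_one_left (norm_nonneg _) (h.abs_le_one x)).trans hD

theorem mul (h : IsCutoff L P Q ψ) (h' : IsCutoff L' P' Q' ψ') :
    IsCutoff (1 * L' + L) (P ∩ P') (Q ∩ Q') (fun x => ψ x * ψ' x) where
  contDiff := h.contDiff.mul h'.contDiff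
  abs_le_one x := by
    rw [abs_mul]
    exact mul_le_one₀ (h.abs_le_one x) (abs_nonneg _) (h'.abs_le_one x)
  norm_fderiv_le x := h'.norm_fderiv_mul_le (h.contDiff.differentiable one_ne_zero x)
    (h.abs_le_one x) (h.norm_fderiv_le x)
  eventuallyEq_one x hx := by
    filter_upwards [h.eventuallyEq_one x hx.1, h'.eventuallyEq_one x hx.2] with y hy hy'
    simp [hy, hy']
  eq_zero x hx := by
    by_cases hxQ : x ∈ Q
    · simp [h'.eq_zero x fun hxQ' => hx ⟨hxQ, hxQ'⟩]
    · simp [h.eq_zero x hxQ]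

theorem prod {P' Q' : Set F} {ψ' : F → ℝ} (h : IsCutoff L P Q ψ) (h' : IsCutoff L' P' Q' ψ') :
    IsCutoff (1 * L' + L) (P ×ˢ P') (Q ×ˢ Q') (fun x : E × F => ψ x.1 * ψ' x.2) :=
  (h.comp contDiff_fst LipschitzWith.prod_fst).mul (h'.comp contDiff_snd LipschitzWith.prod_snd)

end IsCutoff

theorem exists_isCutoff_smoothTransition :
    ∃ L, IsCutoff L (Ioi 1) (Ici 0) Real.smoothTransition := by
  have hzero : ∀ t ∉ Ici (0 : ℝ), Real.smoothTransition t = 0 := fun t ht =>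
    Real.smoothTransition.zero_of_nonpos (not_le.1 ht).le
  have hone : ∀ t ∈ Ioi (1 : ℝ), Real.smoothTransition =ᶠ[𝓝 t] 1 := fun t ht => by
    filter_upwards [Ioi_mem_nhds ht] with s hs
    exact Real.smoothTransition.one_of_one_le (le_of_lt hs)
  have hsupp : HasCompactSupport (fderiv ℝ Real.smoothTransition) := by
    refine HasCompactSupport.intro isCompact_Icc (K := Icc 0 1) fun t ht => ?_
    by_cases h0 : 0 ≤ t
    · rw [(hone t (not_le.1 fun h1 => ht ⟨h0, h1⟩)).fderiv_eq, fderiv_one, Pi.zero_apply]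
    · have hnear : Real.smoothTransition =ᶠ[𝓝 t] 0 := by
        filter_upwards [Iio_mem_nhds (not_le.1 h0)] with s hs
        exact hzero s (notMem_Ici.2 hs)
      rw [hnear.fderiv_eq, fderiv_zero, Pi.zero_apply]
  obtain ⟨L, hL⟩ := hsupp.exists_bound_of_continuous
    ((Real.smoothTransition.contDiff (n := 1)).continuous_fderiv one_ne_zero)
  refine ⟨L, Real.smoothTransition.contDiff, fun t => ?_, hL, hone, hzero⟩
  rw [abs_of_nonneg (Real.smoothTransition.nonneg t)]
  exact Real.smoothTransition.le_one t

/-- A smooth function on the line which is `1` on a neighbourhood of `[a, b]` and `0` outside of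
`[a - 2, b + 2]`. -/
noncomputable def plateau (a b t : ℝ) : ℝ :=
  Real.smoothTransition (t - (a - 2)) * Real.smoothTransition (b + 2 - t)

theorem exists_isCutoff_plateau :
    ∃ L, ∀ a b : ℝ, IsCutoff L (Icc a b) (Icc (a - 2) (b + 2)) (plateau a b) := by
  obtain ⟨L, hL⟩ := exists_isCutoff_smoothTransition
  refine ⟨1 * L + L, fun a b => ?_⟩
  have hleft := hL.comp (A := fun t => t - (a - 2)) (by fun_prop)
    (LipschitzWith.mk_one fun s t => (dist_sub_right s t _).le)
  have hright := hL.comp (A := fun t => b + 2 - t) (by fun_prop)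
    (LipschitzWith.mk_one fun s t => (dist_sub_left _ s t).le)
  refine (hleft.mul hright).mono (fun t ht => ⟨?_, ?_⟩) fun t ht => ⟨?_, ?_⟩
  · exact mem_preimage.2 (mem_Ioi.2 (by linarith [ht.1]))
  · exact mem_preimage.2 (mem_Ioi.2 (by linarith [ht.2]))
  · exact sub_nonneg.1 ht.1
  · exact sub_nonneg.1 ht.2

/-! ### Følner sequences of cut-off functions -/

/-- Cut-off functions `χ k` on `S ⊆ ℝ` which are `1` on the `N k` periods `(t₀, t₀ + N k T]` and
supported in `Q k`, with a common bound for their differentials, such that the part of `S ∩ Q k`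
outside of these periods has asymptotically negligible length. -/
structure FolnerCutoff (S : Set ℝ) (t₀ T : ℝ) where
  N : ℕ → ℕ
  Q : ℕ → Set ℝ
  χ : ℕ → ℝ → ℝ
  N_pos (k : ℕ) : 0 < N k
  exists_isCutoff : ∃ L, ∀ k, IsCutoff L (Ioc t₀ (t₀ + N k * T)) (Q k) (χ k)
  isClosed (k : ℕ) : IsClosed (Q k)
  subset (k : ℕ) : Ioc t₀ (t₀ + N k * T) ⊆ S
  volume_ne_top (k : ℕ) : volume (S ∩ Q k) ≠ ⊤
  tendsto : Tendsto (fun k => volume.real (S ∩ Q k) / (N k * T)) atTop (𝓝 1)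

namespace FolnerCutoff

theorem contDiff {S : Set ℝ} {t₀ T : ℝ} (c : FolnerCutoff S t₀ T) (k : ℕ) :
    ContDiff ℝ 1 (c.χ k) :=
  let ⟨_, hL⟩ := c.exists_isCutoff
  (hL k).contDiff

theorem eq_zero {S : Set ℝ} {t₀ T : ℝ} (c : FolnerCutoff S t₀ T) {k : ℕ} {t : ℝ}
    (ht : t ∉ c.Q k) : c.χ k t = 0 :=
  let ⟨_, hL⟩ := c.exists_isCutoff
  (hL k).eq_zero t ht

variable {T : ℝ}

/-- On a set consisting of one period no cut-off is needed. -/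
noncomputable def period (t₀ : ℝ) (hT : 0 < T) : FolnerCutoff (Ioc t₀ (t₀ + T)) t₀ T where
  N _ := 1
  Q _ := univ
  χ _ := 1
  N_pos _ := one_pos
  exists_isCutoff := ⟨0, fun _ => IsCutoff.one.mono (subset_univ _) subset_rfl⟩
  isClosed _ := isClosed_univ
  subset _ := by simp
  volume_ne_top _ := by simp
  tendsto := by simp [hT.le, hT.ne']

/-- On the line, the `k`-th cut-off function is the plateau over `k + 1` periods. -/
noncomputable def line (t₀ : ℝ) (hT : 0 < T) : FolnerCutoff univ t₀ T where
  N k := k + 1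
  Q k := Icc (t₀ - 2) (t₀ + (k + 1 : ℕ) * T + 2)
  χ k := plateau t₀ (t₀ + (k + 1 : ℕ) * T)
  N_pos := Nat.succ_pos
  exists_isCutoff := exists_isCutoff_plateau.imp fun _ h k => (h _ _).mono Ioc_subset_Icc_self
    subset_rfl
  isClosed _ := isClosed_Icc
  subset _ := subset_univ _
  volume_ne_top _ := by simp
  tendsto := by
    have hlength (k : ℕ) : volume.real (univ ∩ Icc (t₀ - 2) (t₀ + (k + 1 : ℕ) * T + 2)) /
        ((k + 1 : ℕ) * T) = 1 + 4 / T * (1 / ((k : ℝ) + 1)) := by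
      have hlength : 0 < (k + 1 : ℕ) * T := by positivity
      rw [univ_inter, Real.volume_real_Icc_of_le (by linarith)]
      push_cast
      field_simp
      ring
    simpa only [hlength, mul_zero, add_zero] using
      (tendsto_one_div_add_atTop_nhds_zero_nat.const_mul (4 / T)).const_add 1

end FolnerCutoff

theorem measureReal_cell (x₀ : ℝ × ℝ) {T : ℝ × ℝ} (hT₁ : 0 ≤ T.1) (hT₂ : 0 ≤ T.2) :
    volume.real (cell x₀ T) = T.1 * T.2 := by
  rw [cell, Measure.volume_eq_prod, measureReal_prod_prod]
  simp [hT₁, hT₂]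

section Folner

variable {G : ℝ × ℝ → Matrix (Fin 2) (Fin 2) ℝ} {V u : ℝ × ℝ → ℝ}

theorem IsMetric.setIntegral_energyDensity_mul_le (hG : IsMetric G) (hV : Continuous V)
    (hu : ContDiff ℝ 1 u) {L C : ℝ} {S P Q : Set (ℝ × ℝ)} {ψ : ℝ × ℝ → ℝ} (hψ : IsCutoff L P Q ψ)
    (hC : ∀ x, |energyDensity G V (fun y => u y * ψ y) x| ≤ C) (hS : MeasurableSet S)
    (hP : MeasurableSet P) (hQ : IsClosed Q) (hPS : P ⊆ S) (hfin : volume (S ∩ Q) ≠ ⊤) :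
    ∫ x in S, energyDensity G V (fun y => u y * ψ y) x ≤
      (∫ x in P, energyDensity G V u x) + C * (volume.real (S ∩ Q) - volume.real P) := by
  set F := energyDensity G V fun y => u y * ψ y
  have hPSQ : P ⊆ S ∩ Q := subset_inter hPS hψ.subset
  have hF : IntegrableOn F (S ∩ Q) := Measure.integrableOn_of_bounded hfin
    (hG.continuous_energyDensity hV (hu.mul hψ.contDiff)).aestronglyMeasurable
    (Eventually.of_forall hC)
  have hoff : ∀ x ∈ S \ (S ∩ Q), F x = 0 := fun x ⟨hxS, hx⟩ => by
    refine energyDensity_eq_zero ?_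
    filter_upwards [hQ.isOpen_compl.mem_nhds fun hxQ => hx ⟨hxS, hxQ⟩] with y hy
    simp [hψ.eq_zero y hy]
  have hon : ∀ x ∈ P, F x = energyDensity G V u x := fun x hx => by
    refine energyDensity_congr ?_
    filter_upwards [hψ.eventuallyEq_one x hx] with y hy
    simp [hy]
  have hmargin : ∫ x in (S ∩ Q) \ P, F x ≤ C * (volume.real (S ∩ Q) - volume.real P) := by
    rw [← measureReal_sdiff hPSQ hP hfin]
    exact (le_abs_self _).trans (norm_setIntegral_le_of_norm_le_const (f := F)
      (measure_lt_top_mono sdiff_subset hfin.lt_top) fun x _ => hC x)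
  calc ∫ x in S, F x = ∫ x in S ∩ Q, F x :=
        setIntegral_eq_of_subset_of_forall_sdiff_eq_zero hS inter_subset_left hoff
    _ = (∫ x in P, F x) + ∫ x in (S ∩ Q) \ P, F x := by
        rw [← integral_inter_add_sdiff hP hF, inter_eq_right.2 hPSQ]
    _ ≤ _ := by
        rw [setIntegral_congr_fun hP hon]
        gcongr

theorem IsMetric.exists_abs_energyDensity_mul_le {T : ℝ × ℝ} (hG : IsMetric G)
    (hGT : DoublyPeriodic T G) (hV : Continuous V) (hVT : DoublyPeriodic T V) (hu : ContDiff ℝ 1 u)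
    (huT : DoublyPeriodic T u) (hT₁ : 0 < T.1) (hT₂ : 0 < T.2) (L : ℝ) :
    ∃ C, ∀ (P Q : Set (ℝ × ℝ)) (ψ : ℝ × ℝ → ℝ), IsCutoff L P Q ψ →
      ∀ x, |energyDensity G V (fun y => u y * ψ y) x| ≤ C := by
  obtain ⟨B, hB⟩ := huT.exists_norm_le hT₁ hT₂ hu.continuous
  obtain ⟨D, hD⟩ := DoublyPeriodic.exists_norm_le
    ⟨periodic_fderiv huT.fst, periodic_fderiv huT.snd⟩ hT₁ hT₂ (hu.continuous_fderiv one_ne_zero)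
  obtain ⟨C, hC⟩ := hG.exists_abs_energyDensity_le hGT hV hVT hT₁ hT₂ B (B * L + D)
  refine ⟨C, fun P Q ψ hψ x => hC _ x ?_ fun i => ?_⟩
  · rw [abs_mul]
    exact (mul_le_of_le_one_right (abs_nonneg _) (hψ.abs_le_one x)).trans (hB x)
  · exact (abs_partialDeriv_le_norm_fderiv i _ x).trans
      (hψ.norm_fderiv_mul_le (hu.differentiable one_ne_zero x) (hB x) (hD x))

/- The energy of `u χ₁ χ₂` is at most the energy of the periods covered by the plateau plus a
multiple of the area of the margin, which is negligible compared to the number of periods. -/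
theorem IsMetric.setIntegral_cell_nonneg_of_folnerCutoff {T x₀ : ℝ × ℝ} {S₁ S₂ : Set ℝ}
    (hG : IsMetric G) (hGT : DoublyPeriodic T G) (hV : Continuous V) (hVT : DoublyPeriodic T V)
    (hu : ContDiff ℝ 1 u) (huT : DoublyPeriodic T u) (hT₁ : 0 < T.1) (hT₂ : 0 < T.2)
    (φ : FolnerCutoff S₁ x₀.1 T.1) (θ : FolnerCutoff S₂ x₀.2 T.2)
    (hS₁ : MeasurableSet S₁) (hS₂ : MeasurableSet S₂)
    (h : ∀ k, 0 ≤ ∫ z in S₁ ×ˢ S₂,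
      energyDensity G V (fun y => u y * (φ.χ k y.1 * θ.χ k y.2)) z) :
    0 ≤ ∫ z in cell x₀ T, energyDensity G V u z := by
  obtain ⟨L₁, hL₁⟩ := φ.exists_isCutoff
  obtain ⟨L₂, hL₂⟩ := θ.exists_isCutoff
  obtain ⟨C, hC⟩ := hG.exists_abs_energyDensity_mul_le hGT hV hVT hu huT hT₁ hT₂ (1 * L₂ + L₁)
  set q := ∫ z in cell x₀ T, energyDensity G V u z
  set r₁ := fun k => volume.real (S₁ ∩ φ.Q k) / (φ.N k * T.1)
  set r₂ := fun k => volume.real (S₂ ∩ θ.Q k) / (θ.N k * T.2)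
  have hbound (k : ℕ) : 0 ≤ q / (T.1 * T.2) + C * (r₁ k * r₂ k - 1) := by
    have hN₁ : 0 < (φ.N k : ℝ) := Nat.cast_pos.2 (φ.N_pos k)
    have hN₂ : 0 < (θ.N k : ℝ) := Nat.cast_pos.2 (θ.N_pos k)
    have hcut : IsCutoff (1 * L₂ + L₁) (cell x₀ (φ.N k * T.1, θ.N k * T.2)) (φ.Q k ×ˢ θ.Q k)
        fun y => φ.χ k y.1 * θ.χ k y.2 := (hL₁ k).prod (hL₂ k)
    have hfin : volume ((S₁ ×ˢ S₂) ∩ (φ.Q k ×ˢ θ.Q k)) ≠ ⊤ := by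
      rw [prod_inter_prod, Measure.volume_eq_prod, Measure.prod_prod]
      exact ENNReal.mul_ne_top (φ.volume_ne_top k) (θ.volume_ne_top k)
    have hle := (h k).trans (hG.setIntegral_energyDensity_mul_le hV hu hcut (hC _ _ _ hcut)
      (hS₁.prod hS₂) (measurableSet_cell _ _) ((φ.isClosed k).prod (θ.isClosed k))
      (prod_mono (φ.subset k) (θ.subset k)) hfin)
    rw [(hGT.energyDensity hVT huT).setIntegral_block (hG.continuous_energyDensity hV hu) x₀
      hT₁.le hT₂.le, prod_inter_prod, Measure.volume_eq_prod, measureReal_prod_prod,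
      ← Measure.volume_eq_prod, measureReal_cell x₀ (by positivity) (by positivity)] at hle
    calc 0 ≤ (φ.N k * θ.N k * q + C * (volume.real (S₁ ∩ φ.Q k) * volume.real (S₂ ∩ θ.Q k)
          - φ.N k * T.1 * (θ.N k * T.2))) / (φ.N k * T.1 * (θ.N k * T.2)) :=
        div_nonneg hle (by positivity)
      _ = q / (T.1 * T.2) + C * (r₁ k * r₂ k - 1) := by
          simp only [r₁, r₂]
          field_simp
  have hr : Tendsto (fun k => q / (T.1 * T.2) + C * (r₁ k * r₂ k - 1)) atTop
      (𝓝 (q / (T.1 * T.2) + C * (1 * 1 - 1))) :=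
    (((φ.tendsto.mul θ.tendsto).sub_const 1).const_mul C).const_add _
  have hlim := ge_of_tendsto' hr hbound
  rw [mul_one, sub_self, mul_zero, add_zero] at hlim
  simpa using (le_div_iff₀ (mul_pos hT₁ hT₂)).1 hlim

end Folner

/-! ### Surfaces with periodic coordinates -/

section Surface

variable {E : Type*} [NormedAddCommGroup E] [NormedSpace ℝ E]
  {H : Type*} [TopologicalSpace H] {I : ModelWithCorners ℝ E H}
  {M : Type*} [TopologicalSpace M] [ChartedSpace H M] {p : ℝ × ℝ → M}

theorem contDiff_gram [IsManifold I ∞ M] (g : SmoothMetric I M)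
    (hp : ContMDiff 𝓘(ℝ, ℝ × ℝ) I ∞ p) (i j : Fin 2) :
    ContDiff ℝ ∞ fun x => gram g p x i j := by
  have hframe (k : Fin 2) : ContMDiff 𝓘(ℝ, ℝ × ℝ) I.tangent ∞ fun x =>
      (⟨p x, mfderiv 𝓘(ℝ, ℝ × ℝ) I p x (e k)⟩ : TangentBundle I M) := by
    have hconst : ContMDiff 𝓘(ℝ, ℝ × ℝ) 𝓘(ℝ, ℝ × ℝ).tangent ∞ fun x : ℝ × ℝ =>
        (⟨x, e k⟩ : TangentBundle 𝓘(ℝ, ℝ × ℝ) (ℝ × ℝ)) :=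
      fun _ => contMDiffAt_vectorSpace_iff_contDiffAt.2 contDiffAt_const
    exact (hp.contMDiff_tangentMap le_rfl).comp hconst
  have hgram : ContMDiff 𝓘(ℝ, ℝ × ℝ) (I.prod 𝓘(ℝ, ℝ)) ∞ fun x =>
      Bundle.TotalSpace.mk' ℝ (E := Bundle.Trivial M ℝ) (p x) (gram g p x i j) :=
    ContMDiff.clm_bundle_apply₂ (F₁ := E) (F₂ := E) (g.contMDiff.comp hp) (hframe i) (hframe j)
  exact contMDiff_iff_contDiff.1 fun x => (Bundle.contMDiffAt_totalSpace.1 (hgram x)).2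

theorem posDef_gram [IsManifold I 1 M] (g : SmoothMetric I M) {x : ℝ × ℝ}
    (hp : Function.Injective (mfderiv 𝓘(ℝ, ℝ × ℝ) I p x)) : (gram g p x).PosDef := by
  refine Matrix.PosDef.of_dotProduct_mulVec_pos ?_ fun v hv => ?_
  · ext i j
    simpa [gram] using g.symm _ _ _
  · set dp : ℝ × ℝ →L[ℝ] TangentSpace I (p x) := mfderiv 𝓘(ℝ, ℝ × ℝ) I p x
    have hne : dp (v 0 • e 0 + v 1 • e 1) ≠ 0 := fun h => hv <| by
      have hw : v 0 • e 0 + v 1 • e 1 = 0 := hp (h.trans (map_zero dp).symm)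
      ext i
      fin_cases i
      exacts [by simpa [e] using congrArg Prod.fst hw, by simpa [e] using congrArg Prod.snd hw]
    have hgram (i j : Fin 2) : gram g p x i j = g.inner (p x) (dp (e i)) (dp (e j)) := rfl
    refine (g.pos _ _ hne).trans_eq ?_
    simp only [map_add, map_smul, add_apply, smul_apply, smul_eq_mul, dotProduct, Matrix.mulVec,
      Fin.sum_univ_two, Pi.star_apply, star_trivial, hgram]
    ring

theorem periodic_gram [IsManifold I 1 M] (g : SmoothMetric I M)
    (hp : MDifferentiable 𝓘(ℝ, ℝ × ℝ) I p) {τ : M → M} (hτ : MDifferentiable I I τ)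
    (hg : Preserves g τ) {c : ℝ × ℝ} (hc : ∀ x, p (x + c) = τ (p x)) :
    Function.Periodic (gram g p) c := fun x => by
  have hchain : (mfderiv 𝓘(ℝ, ℝ × ℝ) I p (x + c) : (ℝ × ℝ) →L[ℝ] E) =
      (mfderiv I I τ (p x) : E →L[ℝ] E).comp (mfderiv 𝓘(ℝ, ℝ × ℝ) I p x) := by
    have hadd : HasMFDerivAt 𝓘(ℝ, ℝ × ℝ) 𝓘(ℝ, ℝ × ℝ) (· + c) x (ContinuousLinearMap.id ℝ (ℝ × ℝ)) :=
      ((hasFDerivAt_id x).add_const c).hasMFDerivAt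
    have hleft := ((hp (x + c)).hasMFDerivAt.comp x hadd).mfderiv
    rw [show p ∘ (· + c) = τ ∘ p from funext hc, mfderiv_comp x (hτ _) (hp _)] at hleft
    exact hleft.symm
  have hcongr {m m' : M} (hm : m = m') (v w : E) :
      g.inner m (v : TangentSpace I m) (w : TangentSpace I m) =
        g.inner m' (v : TangentSpace I m') (w : TangentSpace I m') := by
    subst hm
    rfl
  ext i j
  refine Eq.trans ?_ (hg (p x) _ _)
  refine (hcongr (hc x) _ _).trans ?_
  exact congrArg (fun A : (ℝ × ℝ) →L[ℝ] E => g.inner (τ (p x)) (A (e i) : TangentSpace I (τ (p x)))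
    (A (e j) : TangentSpace I (τ (p x)))) hchain

/-- A parametrization `p` of the surface `M` by the plane with coordinates `s`, which take their
values in `S₁ ×ˢ S₂`. A function on the plane with periods `(T¹, 0)` and `(0, T²)` times one of
the cut-off functions `φ.χ k ⊗ θ.χ k` must be a `C¹` function with compact support on `M`. -/
structure PeriodicParametrization (I : ModelWithCorners ℝ E H) [MeasurableSpace M]
    (p : ℝ × ℝ → M) (s : M → ℝ × ℝ) where
  contMDiff : ContMDiff 𝓘(ℝ, ℝ × ℝ) I ∞ p
  injective_mfderiv (x : ℝ × ℝ) : Function.Injective (mfderiv 𝓘(ℝ, ℝ × ℝ) I p x)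
  apply_coord (m : M) : p (s m) = m
  measurable_param : Measurable p
  measurable_coord : Measurable s
  T : ℝ × ℝ
  x₀ : ℝ × ℝ
  S₁ : Set ℝ
  S₂ : Set ℝ
  T₁_pos : 0 < T.1
  T₂_pos : 0 < T.2
  measurableSet₁ : MeasurableSet S₁
  measurableSet₂ : MeasurableSet S₂
  range_coord : range s = S₁ ×ˢ S₂
  φ : FolnerCutoff S₁ x₀.1 T.1
  θ : FolnerCutoff S₂ x₀.2 T.2
  exists_descent {u : ℝ × ℝ → ℝ} (hu : ContDiff ℝ 1 u) (huT : DoublyPeriodic T u) (k : ℕ) :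
    ∃ f : M → ℝ, ContMDiff I 𝓘(ℝ, ℝ) 1 f ∧ HasCompactSupport f ∧
      ∀ x, f (p x) = u x * (φ.χ k x.1 * θ.χ k x.2)

namespace PeriodicParametrization

variable [MeasurableSpace M] {s : M → ℝ × ℝ} (P : PeriodicParametrization I p s)
  {V : ℝ × ℝ → ℝ}

include P

theorem isMetric_gram [IsManifold I ∞ M] (g : SmoothMetric I M) : IsMetric (gram g p) where
  contDiff := contDiff_gram g P.contMDiff
  posDef x := posDef_gram g (P.injective_mfderiv x)

theorem measurableSet_range : MeasurableSet (range s) :=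
  P.range_coord ▸ P.measurableSet₁.prod P.measurableSet₂

theorem integral_riemMeasure [IsManifold I ∞ M] (g : SmoothMetric I M) (hV : Continuous V)
    {f : M → ℝ} (hf : ContDiff ℝ 1 fun x => f (p x)) :
    ∫ m, (normSqDiff g p s f m + V (s m) * f m ^ 2) ∂(riemMeasure g p s) =
      ∫ x in range s, energyDensity (gram g p) V (fun x => f (p x)) x := by
  have hG := P.isMetric_gram g
  set Φ : ℝ × ℝ → ℝ := fun x => gradNormSq (gram g p) (fun x => f (p x)) x + V x * f (p x) ^ 2
  have hΦ : Continuous Φ := (hG.continuous_gradNormSq hf).add (hV.mul (hf.continuous.pow 2))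
  have hpull (m : M) : normSqDiff g p s f m + V (s m) * f m ^ 2 = Φ (s m) := by
    simp only [Φ, P.apply_coord]
    rfl
  have hmeas : Measurable fun m => Φ (s m) := hΦ.measurable.comp P.measurable_coord
  simp only [hpull]
  rw [riemMeasure, integral_map P.measurable_param.aemeasurable hmeas.aestronglyMeasurable,
    integral_withDensity_eq_integral_toReal_smul
      hG.contDiff_sqrt_det.continuous.measurable.ennreal_ofReal
      (Eventually.of_forall fun _ => ENNReal.ofReal_lt_top)]
  refine setIntegral_congr_fun P.measurableSet_range ?_
  rintro _ ⟨m, rfl⟩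
  simp only [P.apply_coord, ENNReal.toReal_ofReal (Real.sqrt_nonneg _), smul_eq_mul, energyDensity,
    Φ, mul_comm]

theorem setIntegral_cell_nonneg [IsManifold I ∞ M] (g : SmoothMetric I M)
    (hg : DoublyPeriodic P.T (gram g p)) (hV : Continuous V) (hVT : DoublyPeriodic P.T V)
    (h : IsNonnegative g p s fun m => V (s m)) {u : ℝ × ℝ → ℝ} (hu : ContDiff ℝ 1 u)
    (huT : DoublyPeriodic P.T u) :
    0 ≤ ∫ z in cell P.x₀ P.T, energyDensity (gram g p) V u z := by
  refine (P.isMetric_gram g).setIntegral_cell_nonneg_of_folnerCutoff hg hV hVT hu huT P.T₁_pos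
    P.T₂_pos P.φ P.θ P.measurableSet₁ P.measurableSet₂ fun k => ?_
  obtain ⟨f, hf, hsupp, hfp⟩ := P.exists_descent hu huT k
  have hfp' : ContDiff ℝ 1 fun x => f (p x) :=
    contMDiff_iff_contDiff.1 (hf.comp (P.contMDiff.of_le (by simp)))
  have hint := h f hf hsupp
  rw [P.integral_riemMeasure g hV hfp', P.range_coord] at hint
  simpa only [hfp] using hint

theorem eq_zero_of_isNonnegative [IsManifold I ∞ M] (g : SmoothMetric I M)
    (hg : DoublyPeriodic P.T (gram g p)) (hV : ContDiff ℝ 1 V) (hVT : DoublyPeriodic P.T V)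
    (hmean : ∫ z in cell P.x₀ P.T, V z * √(gram g p z).det ≤ 0)
    (h : IsNonnegative g p s fun m => V (s m)) : V = 0 :=
  (P.isMetric_gram g).eq_zero_of_setIntegral_cell_nonneg hV hVT P.x₀ P.T₁_pos P.T₂_pos hmean
    fun t => P.setIntegral_cell_nonneg g hg hV.continuous hVT h
      (contDiff_const.add (contDiff_const.mul hV)) (hVT.comp fun v => 1 + t * v)

theorem gaussCurvature_eq_zero_of_mem_nonnegSet [IsManifold I ∞ M] (g : SmoothMetric I M)
    (hg : DoublyPeriodic P.T (gram g p)) {a : ℝ} (ha : a ∈ nonnegSet g p s (gaussCurvature g p s))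
    (ha0 : a ≠ 0) (m : M) : gaussCurvature g p s m = 0 := by
  have hG := P.isMetric_gram g
  have hmean : ∫ z in cell P.x₀ P.T,
      a * coordGaussCurvature (gram g p) z * √(gram g p z).det = 0 := by
    simp only [mul_assoc, integral_const_mul, mul_zero,
      hG.setIntegral_coordGaussCurvature_eq_zero hg P.x₀ P.T₁_pos.le P.T₂_pos.le]
  have hzero := P.eq_zero_of_isNonnegative g hg
    (contDiff_const.mul (hG.contDiff_coordGaussCurvature.of_le (by simp)))
    (hg.coordGaussCurvature.comp (a * ·)) hmean.le ha
  exact (mul_eq_zero.1 (congrFun hzero (s m))).resolve_left ha0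

theorem nonnegSet_gaussCurvature_dichotomy [IsManifold I ∞ M] (g : SmoothMetric I M)
    (hg : DoublyPeriodic P.T (gram g p)) :
    (nonnegSet g p s (gaussCurvature g p s) = {0} ∨
      nonnegSet g p s (gaussCurvature g p s) = univ) ∧
    (nonnegSet g p s (gaussCurvature g p s) = univ ↔ ∀ m, gaussCurvature g p s m = 0) := by
  have hgrad (f : M → ℝ) (m : M) : 0 ≤ normSqDiff g p s f m :=
    (P.isMetric_gram g).gradNormSq_nonneg _ _
  have hzero : (0 : ℝ) ∈ nonnegSet g p s (gaussCurvature g p s) := fun f _ _ =>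
    integral_nonneg fun m => by simpa using hgrad f m
  have hflat (hK : ∀ m, gaussCurvature g p s m = 0) :
      nonnegSet g p s (gaussCurvature g p s) = univ :=
    eq_univ_of_forall fun a f _ _ => integral_nonneg fun m => by simpa [hK] using hgrad f m
  refine ⟨?_, fun h => P.gaussCurvature_eq_zero_of_mem_nonnegSet g hg (h ▸ mem_univ 1)
    one_ne_zero, hflat⟩
  by_cases h : nonnegSet g p s (gaussCurvature g p s) ⊆ {0}
  · exact Or.inl (h.antisymm (singleton_subset_iff.2 hzero))
  · obtain ⟨a, ha, ha0⟩ := not_subset.1 h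
    exact Or.inr (hflat (P.gaussCurvature_eq_zero_of_mem_nonnegSet g hg ha ha0))

end PeriodicParametrization

end Surface

/-! ### The plane -/

/-- The plane in its global coordinates, with a cut-off in both directions. -/
noncomputable def planeParametrization :
    PeriodicParametrization planeModel planeParam planeCoord where
  contMDiff := contMDiff_id
  injective_mfderiv x := by
    rw [planeParam, mfderiv_id]
    exact Function.injective_id
  apply_coord _ := rfl
  measurable_param := measurable_id
  measurable_coord := measurable_id
  T := (1, 1)
  x₀ := 0
  S₁ := univ
  S₂ := univ
  T₁_pos := one_pos
  T₂_pos := one_pos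
  measurableSet₁ := MeasurableSet.univ
  measurableSet₂ := MeasurableSet.univ
  range_coord := range_id.trans univ_prod_univ.symm
  φ := FolnerCutoff.line 0 one_pos
  θ := FolnerCutoff.line 0 one_pos
  exists_descent {u} hu _ k := by
    set c := FolnerCutoff.line 0 one_pos
    have hψ : ContDiff ℝ 1 fun x : ℝ × ℝ => c.χ k x.1 * c.χ k x.2 :=
      ((c.contDiff k).comp contDiff_fst).mul ((c.contDiff k).comp contDiff_snd)
    have hzero (x : ℝ × ℝ) (hx : x ∉ c.Q k ×ˢ c.Q k) : u x * (c.χ k x.1 * c.χ k x.2) = 0 := by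
      rcases not_and_or.1 hx with h | h <;> simp [c.eq_zero h]
    exact ⟨_, (hu.mul hψ).contMDiff,
      HasCompactSupport.intro (isCompact_Icc.prod isCompact_Icc) hzero, fun _ => rfl⟩

theorem doublyPeriodic_gram_plane (g : SmoothMetric planeModel (ℝ × ℝ))
    (hg : ∀ k : ℤ × ℤ, Preserves g (planeShift k)) : DoublyPeriodic (1, 1) (gram g planeParam) := by
  have hshift (k : ℤ × ℤ) : MDifferentiable planeModel planeModel (planeShift k) := by
    refine Differentiable.mdifferentiable ?_
    unfold planeShift
    fun_prop
  exact ⟨periodic_gram g mdifferentiable_id (hshift (1, 0)) (hg (1, 0)) fun x => by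
      simp [planeShift, Prod.ext_iff],
    periodic_gram g mdifferentiable_id (hshift (0, 1)) (hg (0, 1)) fun x => by
      simp [planeShift, Prod.ext_iff]⟩

/-! ### The cylinder -/

/-- The coordinates `(θ, t)`, with `θ₀ - π < θ ≤ θ₀ + π`, of a point of the cylinder. Unlike
`cylCoord = cylSection 0`, they can be chosen to be smooth near a given point. -/
noncomputable def cylSection (θ₀ : ℝ) (m : Circle × ℝ) : ℝ × ℝ :=
  (Complex.arg (m.1 * Circle.exp (-θ₀) : Circle) + θ₀, m.2)

theorem cylParam_cylSection (θ₀ : ℝ) (m : Circle × ℝ) : cylParam (cylSection θ₀ m) = m := by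
  simp only [cylParam, cylSection, Circle.exp_add, Circle.exp_arg, Circle.exp_neg,
    inv_mul_cancel_right]

theorem eventually_cylSection_cylParam (x : ℝ × ℝ) :
    ∀ᶠ y in 𝓝 x, cylSection x.1 (cylParam y) = y := by
  filter_upwards [continuousAt_fst.eventually
    (Ioo_mem_nhds (sub_lt_self x.1 Real.pi_pos) (lt_add_of_pos_right x.1 Real.pi_pos))]
    with y hy
  rw [cylSection, cylParam, ← Circle.exp_add, Circle.arg_exp (by linarith [hy.1])
    (by linarith [hy.2]), neg_add_cancel_right]

theorem contMDiffAt_arg_circle {z : Circle} (hz : (z : ℂ) ∈ Complex.slitPlane) :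
    ContMDiffAt (𝓡 1) 𝓘(ℝ, ℝ) ∞ (fun w : Circle => Complex.arg w) z := by
  have := finrank_real_complex_fact'
  have harg : ContDiffAt ℝ ∞ Complex.arg (z : ℂ) := by
    have hlog : ContDiffAt ℝ ∞ (fun w => (Complex.log w).im) (z : ℂ) :=
      Complex.imCLM.contDiff.contDiffAt.comp _ ((Complex.contDiffAt_log hz).restrict_scalars ℝ)
    simpa only [Complex.log_im] using hlog
  exact harg.contMDiffAt.comp z (contMDiff_coe_sphere (E := ℂ) (n := 1)).contMDiffAt

theorem contMDiffAt_cylSection (x : ℝ × ℝ) :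
    ContMDiffAt cylModel 𝓘(ℝ, ℝ × ℝ) ∞ (cylSection x.1) (cylParam x) := by
  have hrotate : ContMDiffAt cylModel (𝓡 1) ∞
      (fun m : Circle × ℝ => m.1 * Circle.exp (-x.1)) (cylParam x) :=
    (contMDiff_mul_right (a := Circle.exp (-x.1))).contMDiffAt.comp _ contMDiffAt_fst
  have hslit : (((cylParam x).1 * Circle.exp (-x.1) : Circle) : ℂ) ∈ Complex.slitPlane := by
    simp [cylParam]
  have hangle : ContMDiffAt cylModel 𝓘(ℝ, ℝ) ∞
      (fun m : Circle × ℝ => Complex.arg (m.1 * Circle.exp (-x.1) : Circle) + x.1) (cylParam x) :=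
    ((contMDiffAt_arg_circle hslit).comp (cylParam x) hrotate).add contMDiffAt_const
  exact hangle.prodMk_space contMDiffAt_snd

theorem contMDiff_cylParam : ContMDiff 𝓘(ℝ, ℝ × ℝ) cylModel ∞ cylParam :=
  (contMDiff_circleExp.comp contDiff_fst.contMDiff).prodMk contDiff_snd.contMDiff

theorem injective_mfderiv_cylParam (x : ℝ × ℝ) :
    Function.Injective (mfderiv 𝓘(ℝ, ℝ × ℝ) cylModel cylParam x) := by
  have hsection := ((contMDiffAt_cylSection x).mdifferentiableAt (by simp)).hasMFDerivAt
  have hparam := (contMDiff_cylParam.mdifferentiable (by simp) x).hasMFDerivAt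
  have hinv := hasMFDerivAt_unique (hsection.comp x hparam)
    ((hasMFDerivAt_id x).congr_of_eventuallyEq (eventually_cylSection_cylParam x))
  exact Function.LeftInverse.injective fun v => congrArg (fun A => A v) hinv

theorem contMDiff_of_comp_cylParam {f : Circle × ℝ → ℝ}
    (hf : ContDiff ℝ 1 fun x => f (cylParam x)) : ContMDiff cylModel 𝓘(ℝ, ℝ) 1 f := fun m => by
  have hsection : f = (fun x => f (cylParam x)) ∘ cylSection (cylCoord m).1 :=
    funext fun m' => by simp only [Function.comp_apply, cylParam_cylSection]
  have hsmooth := contMDiffAt_cylSection (cylCoord m)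
  rw [cylParam_cylCoord] at hsmooth
  rw [hsection]
  exact hf.contMDiff.contMDiffAt.comp m (hsmooth.of_le (by simp))

theorem apply_cylCoord_cylParam {α : Type*} {F : ℝ × ℝ → α}
    (hF : Function.Periodic F (2 * Real.pi, 0)) (x : ℝ × ℝ) : F (cylCoord (cylParam x)) = F x := by
  obtain ⟨hcircle, hline⟩ := Prod.ext_iff.1 (cylParam_cylCoord (cylParam x))
  obtain ⟨n, hn⟩ := Circle.exp_eq_exp.1 hcircle
  have hx : cylCoord (cylParam x) = x + n • ((2 * Real.pi, 0) : ℝ × ℝ) := by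
    ext
    · simp [hn]
    · simpa [cylParam] using hline
  rw [hx]
  exact hF.zsmul n x

theorem measurable_cylParam : Measurable cylParam :=
  (Circle.exp.continuous.measurable.comp measurable_fst).prodMk measurable_snd

theorem measurable_cylCoord : Measurable cylCoord := by
  have hcoe : Continuous fun z : Circle => (z : ℂ) := continuous_subtype_val
  exact (Complex.measurable_arg.comp (hcoe.measurable.comp measurable_fst)).prodMk measurable_snd

/-- The cylinder in its coordinates `(θ, t)`; being compact, the circle needs no cut-off. -/
noncomputable def cylParametrization : PeriodicParametrization cylModel cylParam cylCoord where
  contMDiff := contMDiff_cylParam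
  injective_mfderiv := injective_mfderiv_cylParam
  apply_coord := cylParam_cylCoord
  measurable_param := measurable_cylParam
  measurable_coord := measurable_cylCoord
  T := (2 * Real.pi, 1)
  x₀ := (-Real.pi, 0)
  S₁ := Ioc (-Real.pi) (-Real.pi + 2 * Real.pi)
  S₂ := univ
  T₁_pos := Real.two_pi_pos
  T₂_pos := one_pos
  measurableSet₁ := measurableSet_Ioc
  measurableSet₂ := MeasurableSet.univ
  range_coord := by rw [range_cylCoord, two_mul, neg_add_cancel_left]
  φ := FolnerCutoff.period (-Real.pi) Real.two_pi_pos
  θ := FolnerCutoff.line 0 one_pos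
  exists_descent {u} hu huT k := by
    set c := FolnerCutoff.line 0 one_pos
    set F : ℝ × ℝ → ℝ := fun x => u x * (1 * c.χ k x.2)
    have hF : ContDiff ℝ 1 F :=
      hu.mul (contDiff_const.mul ((c.contDiff k).comp contDiff_snd))
    have hdescent : ∀ x, F (cylCoord (cylParam x)) = F x :=
      apply_cylCoord_cylParam fun x => by simp [F, huT.fst x]
    have hzero (m : Circle × ℝ) (hm : m ∉ univ ×ˢ c.Q k) : F (cylCoord m) = 0 := by
      have hm₂ : m.2 ∉ c.Q k := fun h => hm ⟨mem_univ _, h⟩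
      simp [F, cylCoord, c.eq_zero hm₂]
    exact ⟨fun m => F (cylCoord m), contMDiff_of_comp_cylParam (by simpa only [hdescent] using hF),
      HasCompactSupport.intro (isCompact_univ.prod isCompact_Icc) hzero, hdescent⟩

theorem doublyPeriodic_gram_cyl (g : SmoothMetric cylModel (Circle × ℝ))
    (hg : ∀ k : ℤ, Preserves g (cylShift k)) :
    DoublyPeriodic (2 * Real.pi, 1) (gram g cylParam) := by
  have hp : MDifferentiable 𝓘(ℝ, ℝ × ℝ) cylModel cylParam :=
    contMDiff_cylParam.mdifferentiable (by simp)
  have hshift : ContMDiff cylModel cylModel ∞ (cylShift 1) :=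
    contMDiff_fst.prodMk (contMDiff_snd.add contMDiff_const)
  have hid : Preserves g id := fun m v w => by
    rw [mfderiv_id]
    rfl
  exact ⟨periodic_gram g hp mdifferentiable_id hid fun x => by simp [cylParam, Circle.exp_add],
    periodic_gram g hp (hshift.mdifferentiable (by simp)) (hg 1) fun x => by
      simp [cylParam, cylShift]⟩

end PeriodicSurface

open PeriodicSurface in
theorem corollary2 :
    (∀ g : SmoothMetric planeModel (ℝ × ℝ), (∀ k : ℤ × ℤ, Preserves g (planeShift k)) →
      (nonnegSet g planeParam planeCoord (gaussCurvature g planeParam planeCoord) = {0} ∨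
        nonnegSet g planeParam planeCoord (gaussCurvature g planeParam planeCoord) = Set.univ) ∧
      (nonnegSet g planeParam planeCoord (gaussCurvature g planeParam planeCoord) = Set.univ ↔
        ∀ m, gaussCurvature g planeParam planeCoord m = 0)) ∧
    (∀ g : SmoothMetric cylModel (Circle × ℝ), (∀ k : ℤ, Preserves g (cylShift k)) →
      (nonnegSet g cylParam cylCoord (gaussCurvature g cylParam cylCoord) = {0} ∨
        nonnegSet g cylParam cylCoord (gaussCurvature g cylParam cylCoord) = Set.univ) ∧
      (nonnegSet g cylParam cylCoord (gaussCurvature g cylParam cylCoord) = Set.univ ↔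
        ∀ m, gaussCurvature g cylParam cylCoord m = 0)) := by
  exact ⟨fun g hg => planeParametrization.nonnegSet_gaussCurvature_dichotomy g
      (doublyPeriodic_gram_plane g hg),
    fun g hg => cylParametrization.nonnegSet_gaussCurvature_dichotomy g
      (doublyPeriodic_gram_cyl g hg)⟩
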